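/- Call $\sum_{k\in\mathbb Z} c_k e^{ikt}$ a Fourier series if there is a complex-valued $f\in L_1([-\pi,\pi))$ such that $c_k=\frac1{2\pi}\int_{-\pi}^{\pi} f(t)e^{-ikt}\,dt$ for all $k\in\mathbb Z$. For a complex sequence $c=\{c_k\}_{k\in\mathbb Z}$, the discrete Hilbert transform is $$hc_n=\sum_{k=-\infty}^{\infty}\frac{c_k}{n+\frac12-k}:=\lim_{N\to\infty}\sum_{|k|\le N}\frac{c_k}{n+\frac12-k},\qquad n\in\mathbb Z,$$ whenever the limit exists. (i) If $\sum_{k\in\mathbb Z} c_k e^{ikt}$ is a Fourier series, then $hc_n$ exists for every $n\in\mathbb Z$, and $\lim_{|n|\to\infty}hc_n=0$. (ii) This condition contains Salem's conditions: if $c$ is any complex sequence for which $hc_n$ exists for every $n\in\mathbb Z$ and $hc_n\to0$ as $|n|\to\infty$, then for $a_n=c_n+c_{-n}$ and $b_n=i(c_n-c_{-n})$ the series below converge for every $k=0,1,2,\dots$ and $$\lim_{k\to\infty}k\sum_{n=1}^\infty\frac{a_n}{(k+\frac12)^2-n^2}=0,\qquad \lim_{k\to\infty}\sum_{n=1}^\infty\frac{n\,b_n}{(k+\frac12)^2-n^2}=0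 .$$ (iii) Consequently, if $a_n=\frac1\pi\int_{-\pi}^{\pi}f(t)\cos nt\,dt$ $(n\ge0)$ for some complex-valued $f\in L_1([-\pi,\pi))$, then the first series in (ii) converges for every $k=0,1,2,\dots$ and the first limit relation holds; and if $b_n=\frac1\pi\int_{-\pi}^{\pi}f(t)\sin nt\,dt$ $(n\ge1)$ for some such $f$, then the second series converges for every $k=0,1,2,\dots$ and the second limit relation holds. -/

import Mathlib

open Filter Topology
open scoped Real

noncomputable section

/-- `∑_{k ∈ ℤ} c k e^{ikt}` is a Fourier series: there is a complex-valued `f ∈ L¹(𝕋)`,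
`𝕋 = [-π, π)`, with `c k = (1 / 2π) ∫_𝕋 f t e^{-ikt} dt` for all `k ∈ ℤ`. -/
def IsFourierSeries (c : ℤ → ℂ) : Prop :=
  ∃ f : ℝ → ℂ, MeasureTheory.IntegrableOn f (Set.Ico (-π) π) ∧
    ∀ k : ℤ, c k = 1 / (2 * (π : ℂ)) *
      ∫ t in Set.Ico (-π) π, f t * Complex.exp (-(Complex.I * (k : ℂ) * (t : ℂ)))

/-- `a 0, a 1, …` are the cosine Fourier coefficients of an integrable function on `[-π, π)`. -/
def IsCosineFourierCoeff (a : ℕ → ℂ) : Prop :=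
  ∃ f : ℝ → ℂ, MeasureTheory.IntegrableOn f (Set.Ico (-π) π) ∧
    ∀ n : ℕ, a n = 1 / (π : ℂ) *
      ∫ t in Set.Ico (-π) π, f t * Complex.cos ((n : ℂ) * (t : ℂ))

/-- `b 1, b 2, …` are the sine Fourier coefficients of an integrable function on `[-π, π)`
(the value `b 0` is irrelevant). -/
def IsSineFourierCoeff (b : ℕ → ℂ) : Prop :=
  ∃ f : ℝ → ℂ, MeasureTheory.IntegrableOn f (Set.Ico (-π) π) ∧
    ∀ n : ℕ, 1 ≤ n → b n = 1 / (π : ℂ) *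
      ∫ t in Set.Ico (-π) π, f t * Complex.sin ((n : ℂ) * (t : ℂ))

/-- The two-sided series `∑_{k ∈ ℤ} c k / (n + 1/2 - k)` converges to `s`, as the limit of its
symmetric partial sums `∑_{|k| ≤ N}`. -/
def HasDiscreteHilbertAt (c : ℤ → ℂ) (n : ℤ) (s : ℂ) : Prop :=
  Tendsto (fun N : ℕ => ∑ k ∈ Finset.Icc (-(N : ℤ)) (N : ℤ), c k / ((n : ℂ) + 1 / 2 - (k : ℂ)))
    atTop (𝓝 s)

/-- The discrete Hilbert transform `hc` of `c` exists at every `n ∈ ℤ`, and `hc n → 0` as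
`|n| → ∞`. -/
def DiscreteHilbertVanishes (c : ℤ → ℂ) : Prop :=
  ∃ hc : ℤ → ℂ, (∀ n : ℤ, HasDiscreteHilbertAt c n (hc n)) ∧ Tendsto hc cofinite (𝓝 0)

/-- The series `∑_{n ≥ 1} a n / ((k + 1/2)² - n²)` converge for `k = 0, 1, …`, and `k` times the
sum tends to `0` as `k → ∞`. -/
def SalemCosineCondition (a : ℕ → ℂ) : Prop :=
  ∃ A : ℕ → ℂ,
    (∀ k : ℕ, Tendsto
      (fun N : ℕ => ∑ n ∈ Finset.Icc 1 N, a n / (((k : ℂ) + 1 / 2) ^ 2 - (n : ℂ) ^ 2))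
      atTop (𝓝 (A k))) ∧
    Tendsto (fun k : ℕ => (k : ℂ) * A k) atTop (𝓝 0)

/-- The series `∑_{n ≥ 1} n b n / ((k + 1/2)² - n²)` converge for `k = 0, 1, …`, and the
sum tends to `0` as `k → ∞`. -/
def SalemSineCondition (b : ℕ → ℂ) : Prop :=
  ∃ B : ℕ → ℂ,
    (∀ k : ℕ, Tendsto
      (fun N : ℕ => ∑ n ∈ Finset.Icc 1 N, (n : ℂ) * b n / (((k : ℂ) + 1 / 2) ^ 2 - (n : ℂ) ^ 2))
      atTop (𝓝 (B k))) ∧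
    Tendsto B atTop (𝓝 0)

end

/-!
In the symmetric partial sum of `hc n` for the Fourier coefficients `c` of `f`, the frequencies
`k = n - j` and `k = n + j + 1` carry opposite denominators and combine into a multiple of
`sin ((j + 1/2) t) / (j + 1/2)`. Up to a vanishing remainder the partial sum is thus the integral of
`f t` times `exp (-i (n + 1/2) t)` and a partial sum of a square wave. These are uniformly bounded
and converge to `π / 2 * sign t`, so by dominated convergence `hc n` is `π i` times the Fourier
coefficient of `sign * f` at the frequency `n + 1/2`, and it vanishes at infinity by the
Riemann–Lebesgue lemma. Salem's sums are, by partial fractions and up to the term in `c 0`,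
multiples of the difference and the sum of `hc k` and `hc (-k - 1)`, whose points `k + 1/2` and
`-(k + 1/2)` are opposite.
-/

section

open MeasureTheory Set SummationFilter
open Complex (I)
open scoped FourierTransform

/-! ### Partial sums of the square wave -/

/-- The mean value inequality applied to `f - φ • g` is an integration by parts: it yields the
bound of the second mean value theorem for `∫ φ • g'` without any integral. -/
lemma norm_sub_le_of_hasDerivWithinAt_smul {E : Type*} [NormedAddCommGroup E] [NormedSpace ℝ E]
    {f g g' : ℝ → E} {φ φ' : ℝ → ℝ} {a b M : ℝ} (hab : a ≤ b)
    (hf : ∀ x ∈ Icc a b, HasDerivWithinAt f (φ x • g' x) (Icc a b) x)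
    (hg : ∀ x ∈ Icc a b, HasDerivWithinAt g (g' x) (Icc a b) x)
    (hφ : ∀ x ∈ Icc a b, HasDerivWithinAt φ (φ' x) (Icc a b) x)
    (hφ_nonneg : ∀ x ∈ Icc a b, 0 ≤ φ x) (hφ'_nonpos : ∀ x ∈ Icc a b, φ' x ≤ 0)
    (hgM : ∀ x ∈ Icc a b, ‖g x‖ ≤ M) :
    ‖f b - f a‖ ≤ 2 * M * φ a := by
  have ha := left_mem_Icc.2 hab
  have hb := right_mem_Icc.2 hab
  set h : ℝ → E := fun x ↦ f x - φ x • g x - (f a - φ a • g a)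
  have hh : ∀ x ∈ Icc a b, HasDerivWithinAt h (-(φ' x • g x)) (Icc a b) x := fun x hx ↦ by
    convert! ((hf x hx).sub ((hφ x hx).smul (hg x hx))).sub_const _ using 1
    abel
  have hB : ∀ x ∈ Icc a b, HasDerivWithinAt (fun x ↦ M * (φ a - φ x)) (-φ' x * M) (Icc a b) x :=
    fun x hx ↦ by simpa [mul_comm] using ((hφ x hx).const_sub (φ a)).const_mul M
  have mean_value : ‖h b‖ ≤ M * (φ a - φ b) := by
    refine image_norm_le_of_norm_deriv_right_le_deriv_boundary'
      (fun x hx ↦ (hh x hx).continuousWithinAt)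
      (fun x hx ↦ (hh x (Ico_subset_Icc_self hx)).mono_of_mem_nhdsWithin
        (Icc_mem_nhdsGE_of_mem hx))
      (by simp [h]) (fun x hx ↦ (hB x hx).continuousWithinAt)
      (fun x hx ↦ (hB x (Ico_subset_Icc_self hx)).mono_of_mem_nhdsWithin
        (Icc_mem_nhdsGE_of_mem hx))
      (fun x hx ↦ ?_) hb
    have hx := Ico_subset_Icc_self hx
    rw [norm_neg, norm_smul, Real.norm_of_nonpos (hφ'_nonpos x hx)]
    exact mul_le_mul_of_nonneg_left (hgM x hx) (neg_nonneg.2 (hφ'_nonpos x hx))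
  have boundary : ∀ x ∈ Icc a b, ‖φ x • g x‖ ≤ M * φ x := fun x hx ↦ by
    rw [norm_smul, Real.norm_of_nonneg (hφ_nonneg x hx), mul_comm]
    exact mul_le_mul_of_nonneg_right (hgM x hx) (hφ_nonneg x hx)
  calc ‖f b - f a‖ = ‖h b + φ b • g b - φ a • g a‖ := by congr 1; simp only [h]; abel
    _ ≤ ‖h b‖ + ‖φ b • g b‖ + ‖φ a • g a‖ :=
      (norm_sub_le _ _).trans (add_le_add_left (norm_add_le _ _) _)
    _ ≤ M * (φ a - φ b) + M * φ b + M * φ a :=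
      add_le_add (add_le_add mean_value (boundary b hb)) (boundary a ha)
    _ = 2 * M * φ a := by ring

/-- The partial sums of the Fourier series of the square wave of period `4π` and height `π / 2`.
The scaling makes `[-π, π]` the interval on which the sum of the series is `π / 2 * sign`. -/
noncomputable def squareWaveSum (N : ℕ) (t : ℝ) : ℝ :=
  ∑ j ∈ Finset.range N, Real.sin ((j + 1 / 2) * t) / (j + 1 / 2)

lemma squareWaveSum_neg (N : ℕ) (t : ℝ) : squareWaveSum N (-t) = -squareWaveSum N t := by
  simp [squareWaveSum, neg_div]

lemma squareWaveSum_zero (N : ℕ) : squareWaveSum N 0 = 0 := by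
  simp [squareWaveSum]

lemma abs_squareWaveSum_le_mul (N : ℕ) (t : ℝ) : |squareWaveSum N t| ≤ N * |t| := by
  have hterm : ∀ j ∈ Finset.range N, |Real.sin ((j + 1 / 2) * t) / (j + 1 / 2)| ≤ |t| := by
    intro j _
    have hj : (0 : ℝ) < j + 1 / 2 := by positivity
    rw [abs_div, abs_of_pos hj, div_le_iff₀ hj]
    calc |Real.sin ((j + 1 / 2) * t)| ≤ |(j + 1 / 2) * t| := Real.abs_sin_le_abs
      _ = |t| * (j + 1 / 2) := by rw [abs_mul, abs_of_pos hj, mul_comm]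
  calc |squareWaveSum N t| ≤ ∑ _j ∈ Finset.range N, |t| :=
        (Finset.abs_sum_le_sum_abs _ _).trans (Finset.sum_le_sum hterm)
    _ = N * |t| := by simp

lemma hasDerivAt_squareWaveSum (N : ℕ) (t : ℝ) :
    HasDerivAt (squareWaveSum N) (∑ j ∈ Finset.range N, Real.cos ((j + 1 / 2) * t)) t := by
  refine HasDerivAt.fun_sum fun j _ ↦ ?_
  have hj : (j : ℝ) + 1 / 2 ≠ 0 := by positivity
  have h := ((hasDerivAt_id t).const_mul ((j : ℝ) + 1 / 2)).sin.div_const ((j : ℝ) + 1 / 2)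
  rwa [mul_one, mul_div_cancel_right₀ _ hj] at h

lemma two_mul_sin_half_mul_sum_cos (N : ℕ) (t : ℝ) :
    2 * Real.sin (t / 2) * ∑ j ∈ Finset.range N, Real.cos ((j + 1 / 2) * t) = Real.sin (N * t) := by
  have hcos : ∀ j : ℕ, ((j : ℝ) + 1 / 2) * t = t * j + t / 2 := fun j ↦ by ring
  simp_rw [hcos, mul_assoc, Real.sin_mul_sum_cos]
  rw [show (N - 1) * t / 2 + t / 2 = N * t / 2 by ring, ← mul_assoc, ← Real.sin_two_mul]
  congr 1
  ring

lemma abs_squareWaveSum_sub_le {N : ℕ} (hN : N ≠ 0) {s t : ℝ} (hs : 0 < s) (hst : s ≤ t)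
    (ht : t ≤ π) : |squareWaveSum N t - squareWaveSum N s| ≤ 1 / (N * Real.sin (s / 2)) := by
  have hN' : (0 : ℝ) < N := by positivity
  have hsin : ∀ x ∈ Icc s t, 0 < Real.sin (x / 2) := fun x hx ↦
    Real.sin_pos_of_pos_of_lt_pi (by linarith [hx.1]) (by linarith [hx.2, Real.pi_pos])
  have hcos : ∀ x ∈ Icc s t, 0 ≤ Real.cos (x / 2) := fun x hx ↦
    Real.cos_nonneg_of_mem_Icc ⟨by linarith [hx.1, Real.pi_pos], by linarith [hx.2]⟩
  have h := norm_sub_le_of_hasDerivWithinAt_smul (f := squareWaveSum N)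
    (g := fun x ↦ -Real.cos (N * x) / N) (g' := fun x ↦ Real.sin (N * x))
    (φ := fun x ↦ (2 * Real.sin (x / 2))⁻¹)
    (φ' := fun x ↦ -Real.cos (x / 2) / (2 * Real.sin (x / 2)) ^ 2) (M := 1 / N) hst
    (fun x hx ↦ ?_) (fun x _ ↦ ?_) (fun x hx ↦ ?_) (fun x hx ↦ ?_) (fun x hx ↦ ?_) (fun x _ ↦ ?_)
  · rw [Real.norm_eq_abs] at h
    convert! h using 1
    field_simp
  · have hx0 := (hsin x hx).ne'
    convert! (hasDerivAt_squareWaveSum N x).hasDerivWithinAt using 1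
    rw [smul_eq_mul, ← two_mul_sin_half_mul_sum_cos, inv_mul_cancel_left₀ (by positivity)]
  · have := (((hasDerivAt_id x).const_mul (N : ℝ)).cos.neg.div_const (N : ℝ)).hasDerivWithinAt
      (s := Icc s t)
    simpa [hN'.ne'] using this
  · have := (((hasDerivAt_id x).div_const 2).sin.const_mul 2).inv
      (mul_pos two_pos (hsin x hx)).ne'
    convert! this.hasDerivWithinAt using 2
    simp only [id]
    ring
  · have := hsin x hx
    positivity
  · exact div_nonpos_of_nonpos_of_nonneg (neg_nonpos.2 (hcos x hx)) (sq_nonneg _)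
  · rw [norm_div, norm_neg, Real.norm_of_nonneg hN'.le, Real.norm_eq_abs]
    gcongr
    exact Real.abs_cos_le_one _

lemma abs_squareWaveSum_le (N : ℕ) {t : ℝ} (ht : |t| ≤ π) : |squareWaveSum N t| ≤ 1 + π := by
  rcases eq_or_ne N 0 with rfl | hN
  · simpa [squareWaveSum] using by positivity
  wlog ht0 : 0 ≤ t generalizing t
  · simpa [squareWaveSum_neg] using this (t := -t) (by rwa [abs_neg]) (by linarith)
  rw [abs_of_nonneg ht0] at ht
  have hN' : (0 : ℝ) < N := by positivity
  have near_zero : ∀ s : ℝ, 0 ≤ s → s ≤ 1 / N → |squareWaveSum N s| ≤ 1 := fun s hs0 hs ↦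
    calc |squareWaveSum N s| ≤ N * |s| := abs_squareWaveSum_le_mul N s
      _ ≤ N * (1 / N) := by rw [abs_of_nonneg hs0]; gcongr
      _ = 1 := mul_one_div_cancel hN'.ne'
  rcases le_total t (1 / N) with hsmall | hlarge
  · linarith [near_zero t ht0 hsmall, Real.pi_pos]
  · have jordan : 1 / (N * π) ≤ Real.sin (1 / N / 2) := by
      convert! Real.mul_le_sin (x := 1 / N / 2) (by positivity) (by linarith) using 1
      field_simp
    have increment : |squareWaveSum N t - squareWaveSum N (1 / N)| ≤ π :=
      calc _ ≤ 1 / (N * Real.sin (1 / N / 2)) :=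
            abs_squareWaveSum_sub_le hN (by positivity) hlarge ht
        _ ≤ 1 / (N * (1 / (N * π))) := by gcongr
        _ = π := by field_simp
    calc |squareWaveSum N t|
        = |squareWaveSum N (1 / N) + (squareWaveSum N t - squareWaveSum N (1 / N))| := by
          rw [add_sub_cancel]
      _ ≤ 1 + π := (abs_add_le _ _).trans
          (add_le_add (near_zero _ (by positivity) le_rfl) increment)

lemma tendsto_squareWaveSum_pi : Tendsto (fun N ↦ squareWaveSum N π) atTop (𝓝 (π / 2)) := by
  have hterm : ∀ j : ℕ, Real.sin ((j + 1 / 2) * π) / (j + 1 / 2) =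
      2 * ((-1) ^ j / (2 * j + 1)) := fun j ↦ by
    rw [show ((j : ℝ) + 1 / 2) * π = π / 2 + j * π by ring, Real.sin_add_nat_mul_pi,
      Real.sin_pi_div_two]
    field_simp
  simp_rw [squareWaveSum, hterm, ← Finset.mul_sum]
  convert! Real.tendsto_sum_pi_div_four.const_mul 2 using 2
  ring

lemma tendsto_squareWaveSum {t : ℝ} (ht : |t| ≤ π) :
    Tendsto (fun N ↦ squareWaveSum N t) atTop (𝓝 (π / 2 * t.sign)) := by
  have of_pos : ∀ s : ℝ, 0 < s → s ≤ π →
      Tendsto (fun N ↦ squareWaveSum N s) atTop (𝓝 (π / 2)) := by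
    intro s hs hsπ
    have hdiff : Tendsto (fun N ↦ squareWaveSum N π - squareWaveSum N s) atTop (𝓝 0) := by
      refine squeeze_zero_norm' (a := fun N : ℕ ↦ 1 / (N : ℝ) * (1 / Real.sin (s / 2))) ?_ ?_
      · filter_upwards [eventually_ne_atTop 0] with N hN
        simpa [mul_comm] using abs_squareWaveSum_sub_le hN hs hsπ le_rfl
      · simpa using tendsto_one_div_atTop_nhds_zero_nat.mul_const (1 / Real.sin (s / 2))
    simpa using tendsto_squareWaveSum_pi.sub hdiff
  rcases lt_trichotomy t 0 with hneg | rfl | hpos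
  · have := of_pos (-t) (neg_pos.2 hneg) ((neg_le_abs t).trans ht)
    simpa [squareWaveSum_neg, Real.sign_of_neg hneg] using this.neg
  · simp [squareWaveSum_zero]
  · simpa [Real.sign_of_pos hpos] using of_pos t hpos ((le_abs_self t).trans ht)

/-! ### The kernel of the discrete Hilbert transform -/

/-- The trigonometric polynomial against which a function is integrated to give the `N`-th
symmetric partial sum of the discrete Hilbert transform, at `n = 0`, of its Fourier coefficients. -/
noncomputable def hilbertKernel (N : ℕ) (t : ℝ) : ℂ :=
  ∑ k ∈ Finset.Icc (-(N : ℤ)) N, Complex.exp (-(I * k * t)) / (1 / 2 - k)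

lemma continuous_hilbertKernel (N : ℕ) : Continuous (hilbertKernel N) := by
  unfold hilbertKernel
  fun_prop

lemma exp_natCast_sub_exp_neg_natCast_add_one (N : ℕ) (t : ℝ) :
    Complex.exp (I * N * t) - Complex.exp (-(I * (N + 1) * t)) =
      2 * I * Complex.exp (-(I * t / 2)) * Real.sin ((N + 1 / 2) * t) := by
  have hpos : Complex.exp (I * N * t) =
      Complex.exp (-(I * t / 2)) * Complex.exp ((N + 1 / 2) * t * I) := by
    rw [← Complex.exp_add]; congr 1; ring
  have hneg : Complex.exp (-(I * (N + 1) * t)) =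
      Complex.exp (-(I * t / 2)) * Complex.exp (-((N + 1 / 2) * t) * I) := by
    rw [← Complex.exp_add]; congr 1; ring
  push_cast
  rw [hpos, hneg, Complex.sin]
  linear_combination Complex.exp (-(I * t / 2)) * (Complex.exp (-((N + 1 / 2) * t) * I) -
    Complex.exp ((N + 1 / 2) * t * I)) * -Complex.I_sq

/-- The terms `k = -j` and `k = j + 1` have opposite denominators and combine into the `j`-th term
of the square wave; the term `k = -N` is left over. -/
lemma hilbertKernel_eq (N : ℕ) (t : ℝ) :
    hilbertKernel N t = 2 * I * Complex.exp (-(I * t / 2)) * squareWaveSum N t +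
      Complex.exp (I * N * t) / (N + 1 / 2) := by
  induction N with
  | zero => simp [hilbertKernel, squareWaveSum]
  | succ N ih =>
    have hpair : Complex.exp (I * N * t) / (N + 1 / 2) +
        Complex.exp (-(I * (N + 1) * t)) / (1 / 2 - (N + 1)) =
        2 * I * Complex.exp (-(I * t / 2)) * (Real.sin ((N + 1 / 2) * t) / (N + 1 / 2)) := by
      rw [← mul_div_assoc, ← exp_natCast_sub_exp_neg_natCast_add_one,
        show (1 / 2 - (N + 1) : ℂ) = -(N + 1 / 2) by ring, div_neg, ← sub_eq_add_neg, sub_div]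
    have hkernel : hilbertKernel (N + 1) t =
        Complex.exp (-(I * (N + 1) * t)) / (1 / 2 - (N + 1)) +
          Complex.exp (I * (N + 1) * t) / (N + 1 + 1 / 2) + hilbertKernel N t := by
      simp only [hilbertKernel, Nat.cast_succ, Finset.sum_Icc_succ_eq_add_endpoints]
      push_cast
      congr 4 <;> ring
    have hwave : squareWaveSum (N + 1) t =
        squareWaveSum N t + Real.sin ((N + 1 / 2) * t) / (N + 1 / 2) :=
      Finset.sum_range_succ _ _
    rw [hkernel, ih, hwave]
    push_cast at hpair ⊢
    linear_combination hpair

lemma norm_hilbertKernel_remainder (N : ℕ) (t : ℝ) :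
    ‖Complex.exp (I * N * t) / (N + 1 / 2)‖ = 1 / ((N : ℝ) + 1 / 2) := by
  have hexp : ‖Complex.exp (I * N * t)‖ = 1 := by
    simpa [mul_assoc] using Complex.norm_exp_I_mul_ofReal (N * t)
  have hden : ‖(N + 1 / 2 : ℂ)‖ = N + 1 / 2 := by
    simpa using Complex.norm_of_nonneg (r := (N : ℝ) + 1 / 2) (by positivity)
  rw [norm_div, hexp, hden]

lemma norm_hilbertKernel_le (N : ℕ) {t : ℝ} (ht : |t| ≤ π) :
    ‖hilbertKernel N t‖ ≤ 2 * (1 + π) + 2 := by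
  have hexp : ‖Complex.exp (-(I * t / 2))‖ = 1 := by
    simpa [mul_div_assoc] using Complex.norm_exp_I_mul_ofReal (-(t / 2))
  have hmain : ‖2 * I * Complex.exp (-(I * t / 2)) * squareWaveSum N t‖ ≤ 2 * (1 + π) := by
    simpa [hexp] using abs_squareWaveSum_le N ht
  have hrem : 1 / ((N : ℝ) + 1 / 2) ≤ 2 := by
    rw [div_le_iff₀ (by positivity)]
    linarith [(N.cast_nonneg : (0 : ℝ) ≤ N)]
  rw [hilbertKernel_eq]
  exact (norm_add_le _ _).trans
    (add_le_add hmain ((norm_hilbertKernel_remainder N t).trans_le hrem))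

lemma tendsto_hilbertKernel {t : ℝ} (ht : |t| ≤ π) :
    Tendsto (fun N ↦ hilbertKernel N t) atTop
      (𝓝 (π * I * t.sign * Complex.exp (-(I * t / 2)))) := by
  have hmain := ((Complex.continuous_ofReal.tendsto _).comp (tendsto_squareWaveSum ht)).const_mul
    (2 * I * Complex.exp (-(I * t / 2)))
  have hrem : Tendsto (fun N : ℕ ↦ Complex.exp (I * N * t) / (N + 1 / 2)) atTop (𝓝 0) := by
    refine squeeze_zero_norm (fun N ↦ (norm_hilbertKernel_remainder N t).le) ?_
    simp only [one_div]
    exact (tendsto_atTop_add_const_right _ _ tendsto_natCast_atTop_atTop).inv_tendsto_atTop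
  simp_rw [hilbertKernel_eq]
  convert! hmain.add hrem using 2
  push_cast
  ring

/-! ### Fourier coefficients at real frequencies -/

/-- The Fourier coefficient of `f` on `[-π, π)` at a real frequency. The discrete Hilbert transform
of the coefficients at integer frequencies is expressed through those of `t ↦ t.sign * f t` at
half-integer ones. -/
noncomputable def fourierCoeffAt (f : ℝ → ℂ) (ξ : ℝ) : ℂ :=
  1 / (2 * π) * ∫ t in Ico (-π) π, f t * Complex.exp (-(I * ξ * t))

lemma integrableOn_mul_exp {f : ℝ → ℂ} {s : Set ℝ} (hf : IntegrableOn f s) (ξ : ℝ) :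
    IntegrableOn (fun t : ℝ ↦ f t * Complex.exp (-(I * ξ * t))) s := by
  refine Integrable.mul_bdd (c := 1) hf (Continuous.aestronglyMeasurable (by fun_prop)) ?_
  refine Eventually.of_forall fun t ↦ ?_
  simpa [mul_assoc] using (Complex.norm_exp_I_mul_ofReal (-(ξ * t))).le

lemma fourierCoeffAt_mul_exp (f : ℝ → ℂ) (η ξ : ℝ) :
    fourierCoeffAt (fun t ↦ f t * Complex.exp (-(I * η * t))) ξ = fourierCoeffAt f (ξ + η) := by
  unfold fourierCoeffAt
  congr 2 with t
  rw [mul_assoc, ← Complex.exp_add]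
  congr 2
  push_cast
  ring

lemma fourierCoeffAt_eq_fourier (f : ℝ → ℂ) (ξ : ℝ) :
    fourierCoeffAt f ξ = 1 / (2 * π) * 𝓕 ((Ico (-π) π).indicator f) ((2 * π)⁻¹ * ξ) := by
  have hπ : (π : ℂ) ≠ 0 := Complex.ofReal_ne_zero.2 Real.pi_ne_zero
  rw [fourierCoeffAt, Real.fourier_real_eq_integral_exp_smul,
    ← integral_indicator measurableSet_Ico]
  congr 2 with t
  by_cases ht : t ∈ Ico (-π) π
  · simp only [indicator_of_mem ht, smul_eq_mul, mul_comm (f t)]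
    congr 2
    push_cast
    field_simp
  · simp only [indicator_of_notMem ht, smul_zero]

lemma tendsto_fourierCoeffAt_cocompact (f : ℝ → ℂ) :
    Tendsto (fourierCoeffAt f) (cocompact ℝ) (𝓝 0) := by
  have hscale : Tendsto (fun ξ : ℝ ↦ (2 * π)⁻¹ * ξ) (cocompact ℝ) (cocompact ℝ) :=
    (Homeomorph.mulLeft₀ (2 * π)⁻¹ (by positivity)).isClosedEmbedding.tendsto_cocompact
  have h := ((Real.zero_at_infty_fourier ((Ico (-π) π).indicator f)).comp hscale).const_mul
    (1 / (2 * π : ℂ))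
  rw [mul_zero] at h
  exact h.congr fun ξ ↦ (fourierCoeffAt_eq_fourier f ξ).symm

lemma tendsto_intCast_add_cocompact (η : ℝ) :
    Tendsto (fun k : ℤ ↦ (k : ℝ) + η) cofinite (cocompact ℝ) :=
  (Homeomorph.addRight η).isClosedEmbedding.tendsto_cocompact.comp Int.tendsto_coe_cofinite

lemma tendsto_fourierCoeffAt_intCast_add (f : ℝ → ℂ) (η : ℝ) :
    Tendsto (fun k : ℤ ↦ fourierCoeffAt f (k + η)) cofinite (𝓝 0) :=
  (tendsto_fourierCoeffAt_cocompact f).comp (tendsto_intCast_add_cocompact η)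

lemma sum_fourierCoeffAt_div {f : ℝ → ℂ} (hf : IntegrableOn f (Ico (-π) π)) (N : ℕ) :
    ∑ k ∈ Finset.Icc (-(N : ℤ)) N, fourierCoeffAt f k / (1 / 2 - k) =
      1 / (2 * π) * ∫ t in Ico (-π) π, f t * hilbertKernel N t := by
  have hint : ∀ k : ℤ, IntegrableOn
      (fun t : ℝ ↦ f t * (Complex.exp (-(I * k * t)) / (1 / 2 - k))) (Ico (-π) π) := fun k ↦ by
    simpa [IntegrableOn, mul_div_assoc] using (integrableOn_mul_exp hf k).div_const (1 / 2 - k : ℂ)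
  simp only [hilbertKernel, Finset.mul_sum]
  rw [integral_finsetSum _ fun k _ ↦ hint k, Finset.mul_sum]
  refine Finset.sum_congr rfl fun k _ ↦ ?_
  simp only [fourierCoeffAt, ← mul_div_assoc, integral_div, Complex.ofReal_intCast]

lemma hasSum_fourierCoeffAt_div {f : ℝ → ℂ} (hf : IntegrableOn f (Ico (-π) π)) :
    HasSum (fun k : ℤ ↦ fourierCoeffAt f k / (1 / 2 - k))
      (π * I * fourierCoeffAt (fun t ↦ t.sign * f t) (1 / 2)) (symmetricIcc ℤ) := by
  have habs : ∀ᵐ t ∂volume.restrict (Ico (-π) π), |t| ≤ π := by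
    filter_upwards [ae_restrict_mem measurableSet_Ico] with t ht using abs_le.2 ⟨ht.1, ht.2.le⟩
  have hlim : Tendsto (fun N ↦ ∫ t in Ico (-π) π, f t * hilbertKernel N t) atTop
      (𝓝 (∫ t in Ico (-π) π, f t * (π * I * t.sign * Complex.exp (-(I * t / 2))))) := by
    refine tendsto_integral_of_dominated_convergence (fun t ↦ ‖f t‖ * (2 * (1 + π) + 2))
      (fun N ↦ hf.aestronglyMeasurable.mul (continuous_hilbertKernel N).aestronglyMeasurable)
      (hf.norm.mul_const _) (fun N ↦ ?_) ?_
    · filter_upwards [habs] with t ht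
      rw [norm_mul]
      gcongr
      exact norm_hilbertKernel_le N ht
    · filter_upwards [habs] with t ht using (tendsto_hilbertKernel ht).const_mul _
  rw [hasSum_symmetricIcc_iff]
  simp_rw [sum_fourierCoeffAt_div hf]
  convert! hlim.const_mul (1 / (2 * π : ℂ)) using 2
  rw [fourierCoeffAt, mul_left_comm, ← integral_const_mul]
  congr 2 with t
  push_cast
  ring_nf

/-! ### The discrete Hilbert transform of Fourier coefficients -/

lemma sum_Icc_neg_comp_add_one {M : Type*} [AddCommGroup M] (f : ℤ → M) (N : ℕ) :
    ∑ k ∈ Finset.Icc (-(N : ℤ)) N, f (k + 1) =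
      ∑ k ∈ Finset.Icc (-(N : ℤ)) N, f k + (f (N + 1) - f (-N)) := by
  induction N with
  | zero => simp
  | succ N ih =>
    simp only [Nat.cast_succ, Finset.sum_Icc_succ_eq_add_endpoints, ih]
    rw [show -((N : ℤ) + 1) + 1 = -N by ring]
    abel

section Shift

variable {M : Type*} [AddCommGroup M] [TopologicalSpace M] [IsTopologicalAddGroup M]
  {f : ℤ → M} {s : M}

lemma hasSum_symmetricIcc_comp_add_one_iff (hf : Tendsto f cofinite (𝓝 0)) :
    HasSum (fun k ↦ f (k + 1)) s (symmetricIcc ℤ) ↔ HasSum f s (symmetricIcc ℤ) := by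
  have hright : Tendsto (fun N : ℕ ↦ f (N + 1)) atTop (𝓝 0) := by
    rw [← Nat.cofinite_eq_atTop]
    exact hf.comp (Function.Injective.tendsto_cofinite fun a b h ↦ by simpa using h)
  have hleft : Tendsto (fun N : ℕ ↦ f (-N)) atTop (𝓝 0) := by
    rw [← Nat.cofinite_eq_atTop]
    exact hf.comp (Function.Injective.tendsto_cofinite fun a b h ↦ by simpa using h)
  have hends := hright.sub hleft
  simp_rw [hasSum_symmetricIcc_iff, sum_Icc_neg_comp_add_one]
  exact ⟨fun h ↦ by simpa using h.sub hends, fun h ↦ by simpa using h.add hends⟩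

lemma hasSum_symmetricIcc_comp_add_iff (hf : Tendsto f cofinite (𝓝 0)) (d : ℤ) :
    HasSum (fun k ↦ f (k + d)) s (symmetricIcc ℤ) ↔ HasSum f s (symmetricIcc ℤ) := by
  have hshift : ∀ d : ℤ, Tendsto (fun k ↦ f (k + d)) cofinite (𝓝 0) := fun d ↦
    hf.comp (add_left_injective d).tendsto_cofinite
  induction d with
  | zero => simp
  | succ d ih =>
    refine Iff.trans ?_ ih
    rw [← hasSum_symmetricIcc_comp_add_one_iff (hshift d)]
    simp only [add_assoc, add_comm 1 (d : ℤ)]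
  | pred d ih =>
    refine Iff.trans ?_ ih
    rw [← hasSum_symmetricIcc_comp_add_one_iff (hshift (-d - 1))]
    simp only [add_assoc, add_sub_cancel]

end Shift

lemma tendsto_inv_half_sub_intCast :
    Tendsto (fun k : ℤ ↦ (1 / 2 - k : ℂ)⁻¹) cofinite (𝓝 0) := by
  have hreal : Tendsto (fun k : ℤ ↦ ((k : ℝ) + -(1 / 2))⁻¹) cofinite (𝓝 0) := by
    refine tendsto_inv₀_cobounded.comp ?_
    rw [Metric.cobounded_eq_cocompact]
    exact tendsto_intCast_add_cocompact _
  have hcomplex := (Complex.continuous_ofReal.tendsto _).comp hreal.neg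
  simp only [neg_zero, Complex.ofReal_zero] at hcomplex
  refine hcomplex.congr fun k ↦ ?_
  rw [Function.comp_apply, ← inv_neg]
  push_cast
  ring_nf

lemma hasDiscreteHilbertAt_iff_hasSum {c : ℤ → ℂ} {n : ℤ} {s : ℂ} :
    HasDiscreteHilbertAt c n s ↔
      HasSum (fun k : ℤ ↦ c k / (n + 1 / 2 - k)) s (symmetricIcc ℤ) :=
  hasSum_symmetricIcc_iff.symm

lemma hasDiscreteHilbertAt_fourierCoeffAt {f : ℝ → ℂ} (hf : IntegrableOn f (Ico (-π) π)) (n : ℤ) :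
    HasDiscreteHilbertAt (fun k ↦ fourierCoeffAt f k) n
      (π * I * fourierCoeffAt (fun t ↦ t.sign * f t) (n + 1 / 2)) := by
  have hmod := hasSum_fourierCoeffAt_div (integrableOn_mul_exp hf n)
  simp only [← mul_assoc, fourierCoeffAt_mul_exp] at hmod
  have hzero : Tendsto (fun k : ℤ ↦ fourierCoeffAt f (k + n) / (1 / 2 - k)) cofinite (𝓝 0) := by
    simpa [div_eq_mul_inv] using
      (tendsto_fourierCoeffAt_intCast_add f n).mul tendsto_inv_half_sub_intCast
  rw [hasDiscreteHilbertAt_iff_hasSum, add_comm (n : ℝ)]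
  convert! (hasSum_symmetricIcc_comp_add_iff hzero (-n)).2 hmod using 2 with k
  push_cast
  ring_nf

theorem discreteHilbertVanishes_fourierCoeffAt {f : ℝ → ℂ} (hf : IntegrableOn f (Ico (-π) π)) :
    DiscreteHilbertVanishes (fun k ↦ fourierCoeffAt f k) :=
  ⟨_, hasDiscreteHilbertAt_fourierCoeffAt hf, by
    simpa using (tendsto_fourierCoeffAt_intCast_add _ (1 / 2)).const_mul (π * I)⟩

theorem IsFourierSeries.discreteHilbertVanishes {c : ℤ → ℂ} (hc : IsFourierSeries c) :
    DiscreteHilbertVanishes c := by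
  obtain ⟨f, hf, hcf⟩ := hc
  obtain rfl : c = fun k : ℤ ↦ fourierCoeffAt f k := funext fun k ↦ by simp [hcf, fourierCoeffAt]
  exact discreteHilbertVanishes_fourierCoeffAt hf

/-! ### Salem's conditions -/

lemma sum_Icc_neg_eq_add_sum_Icc_one {M : Type*} [AddCommGroup M] (f : ℤ → M) (N : ℕ) :
    ∑ k ∈ Finset.Icc (-(N : ℤ)) N, f k = f 0 + ∑ n ∈ Finset.Icc 1 N, (f n + f (-n)) := by
  induction N with
  | zero => simp
  | succ N ih =>
    rw [Finset.sum_Icc_succ_top (by omega)]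
    simp only [Nat.cast_succ, Finset.sum_Icc_succ_eq_add_endpoints, ih]
    abel

section PartialFractions

variable {K : Type*} [Field K] (c : ℤ → K) {x : K}

lemma sum_div_sub_sub_sum_div_neg_sub (hx : ∀ m : ℤ, x ≠ m) (N : ℕ) :
    ∑ j ∈ Finset.Icc (-(N : ℤ)) N, c j / (x - j) - ∑ j ∈ Finset.Icc (-(N : ℤ)) N, c j / (-x - j) =
      2 * c 0 / x + 2 * x * ∑ n ∈ Finset.Icc 1 N, (c n + c (-n)) / (x ^ 2 - (n : K) ^ 2) := by
  rw [← Finset.sum_sub_distrib, sum_Icc_neg_eq_add_sum_Icc_one, Finset.mul_sum]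
  congr 1
  · simp only [Int.cast_zero, sub_zero, div_neg]
    ring
  refine Finset.sum_congr rfl fun n _ ↦ ?_
  have hsub : x - n ≠ 0 := sub_ne_zero.2 (mod_cast hx n)
  have hadd : x + n ≠ 0 := fun h ↦ hx (-n) (by push_cast; exact eq_neg_of_add_eq_zero_left h)
  push_cast
  rw [show -x - (n : K) = -(x + n) by ring, show -x - -(n : K) = -(x - n) by ring, sub_neg_eq_add,
    sq_sub_sq]
  field_simp
  ring

lemma sum_div_sub_add_sum_div_neg_sub (hx : ∀ m : ℤ, x ≠ m) (N : ℕ) :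
    ∑ j ∈ Finset.Icc (-(N : ℤ)) N, c j / (x - j) + ∑ j ∈ Finset.Icc (-(N : ℤ)) N, c j / (-x - j) =
      2 * ∑ n ∈ Finset.Icc 1 N, n * (c n - c (-n)) / (x ^ 2 - (n : K) ^ 2) := by
  rw [← Finset.sum_add_distrib, sum_Icc_neg_eq_add_sum_Icc_one, Finset.mul_sum]
  simp only [Int.cast_zero, sub_zero, div_neg, add_neg_cancel, zero_add]
  refine Finset.sum_congr rfl fun n _ ↦ ?_
  have hsub : x - n ≠ 0 := sub_ne_zero.2 (mod_cast hx n)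
  have hadd : x + n ≠ 0 := fun h ↦ hx (-n) (by push_cast; exact eq_neg_of_add_eq_zero_left h)
  push_cast
  rw [show -x - (n : K) = -(x + n) by ring, show -x - -(n : K) = -(x - n) by ring, sub_neg_eq_add,
    sq_sub_sq]
  field_simp
  ring

end PartialFractions

lemma natCast_add_half_ne_intCast (k : ℕ) (m : ℤ) : (k : ℂ) + 1 / 2 ≠ m := by
  intro h
  have : (2 * k + 1 : ℤ) = 2 * m := by
    exact_mod_cast (by linear_combination 2 * h : (2 * k + 1 : ℂ) = 2 * m)
  omega

section Salem

variable {c : ℤ → ℂ}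

lemma intCast_neg_natCast_sub_one_add_half (k : ℕ) :
    ((-k - 1 : ℤ) : ℂ) + 1 / 2 = -((k : ℂ) + 1 / 2) := by
  push_cast
  ring

/-- The points `n = k` and `n = -k - 1` are used because their `n + 1 / 2` are opposite. -/
lemma HasDiscreteHilbertAt.tendsto_sum_salemCosine {k : ℕ} {s s' : ℂ}
    (hs : HasDiscreteHilbertAt c k s) (hs' : HasDiscreteHilbertAt c (-k - 1) s') :
    Tendsto (fun N : ℕ ↦ ∑ n ∈ Finset.Icc 1 N,
        (c n + c (-n)) / (((k : ℂ) + 1 / 2) ^ 2 - (n : ℂ) ^ 2))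
      atTop (𝓝 ((s - s' - 2 * c 0 / (k + 1 / 2)) / (k + 1 / 2) / 2)) := by
  have hx : (k : ℂ) + 1 / 2 ≠ 0 := mod_cast natCast_add_half_ne_intCast k 0
  refine ((((hs.sub hs').sub_const (2 * c 0 / (k + 1 / 2))).div_const _).div_const 2).congr
    fun N ↦ ?_
  rw [intCast_neg_natCast_sub_one_add_half, Int.cast_natCast,
    sum_div_sub_sub_sum_div_neg_sub c (natCast_add_half_ne_intCast k), add_sub_cancel_left,
    mul_right_comm, mul_div_cancel_right₀ _ hx, mul_div_cancel_left₀ _ two_ne_zero]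

lemma HasDiscreteHilbertAt.tendsto_sum_salemSine {k : ℕ} {s s' : ℂ}
    (hs : HasDiscreteHilbertAt c k s) (hs' : HasDiscreteHilbertAt c (-k - 1) s') :
    Tendsto (fun N : ℕ ↦ ∑ n ∈ Finset.Icc 1 N,
        n * (I * (c n - c (-n))) / (((k : ℂ) + 1 / 2) ^ 2 - (n : ℂ) ^ 2))
      atTop (𝓝 (I / 2 * (s + s'))) := by
  refine ((hs.add hs').const_mul (I / 2)).congr fun N ↦ ?_
  rw [intCast_neg_natCast_sub_one_add_half, Int.cast_natCast,
    sum_div_sub_add_sum_div_neg_sub c (natCast_add_half_ne_intCast k), ← mul_assoc,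
    div_mul_cancel₀ I two_ne_zero, Finset.mul_sum]
  exact Finset.sum_congr rfl fun n _ ↦ by ring

lemma tendsto_natCast_cofinite_int : Tendsto (fun k : ℕ ↦ (k : ℤ)) atTop cofinite := by
  rw [← Nat.cofinite_eq_atTop]
  exact Nat.cast_injective.tendsto_cofinite

lemma tendsto_neg_natCast_sub_one_cofinite_int :
    Tendsto (fun k : ℕ ↦ -(k : ℤ) - 1) atTop cofinite := by
  rw [← Nat.cofinite_eq_atTop]
  exact Function.Injective.tendsto_cofinite fun a b h ↦ by simpa using h

theorem DiscreteHilbertVanishes.salemCosineCondition (h : DiscreteHilbertVanishes c) :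
    SalemCosineCondition (fun n : ℕ ↦ c n + c (-n)) := by
  obtain ⟨hc, hsum, hlim⟩ := h
  refine ⟨_, fun k ↦ (hsum k).tendsto_sum_salemCosine (hsum (-k - 1)), ?_⟩
  have hdiff := (hlim.comp tendsto_natCast_cofinite_int).sub
    (hlim.comp tendsto_neg_natCast_sub_one_cofinite_int)
  have hden : Tendsto (fun k : ℕ ↦ (k : ℂ) + 1 / 2) atTop (Bornology.cobounded ℂ) :=
    (tendsto_add_const_cobounded (1 / 2 : ℂ)).comp tendsto_natCast_atTop_cobounded
  have hcenter : Tendsto (fun k : ℕ ↦ 2 * c 0 / ((k : ℂ) + 1 / 2)) atTop (𝓝 0) := by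
    simpa only [div_eq_mul_inv, mul_zero, Function.comp_def] using
      (tendsto_inv₀_cobounded.comp hden).const_mul (2 * c 0)
  have hratio := (tendsto_natCast_div_add_atTop (1 / 2 : ℂ)).mul (hdiff.sub hcenter)
  have := hratio.div_const 2
  simp only [sub_zero, mul_zero, zero_div] at this
  refine this.congr fun k ↦ ?_
  simp only [Function.comp_apply]
  ring

theorem DiscreteHilbertVanishes.salemSineCondition (h : DiscreteHilbertVanishes c) :
    SalemSineCondition (fun n : ℕ ↦ I * (c n - c (-n))) := by
  obtain ⟨hc, hsum, hlim⟩ := h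
  refine ⟨_, fun k ↦ (hsum k).tendsto_sum_salemSine (hsum (-k - 1)), ?_⟩
  simpa using ((hlim.comp tendsto_natCast_cofinite_int).add
    (hlim.comp tendsto_neg_natCast_sub_one_cofinite_int)).const_mul (I / 2)

end Salem

section RealForm

variable {f : ℝ → ℂ}

lemma fourierCoeffAt_add_fourierCoeffAt_neg (hf : IntegrableOn f (Ico (-π) π)) (ξ : ℝ) :
    fourierCoeffAt f ξ + fourierCoeffAt f (-ξ) =
      1 / π * ∫ t in Ico (-π) π, f t * Complex.cos (ξ * t) := by
  rw [fourierCoeffAt, fourierCoeffAt, ← mul_add,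
    ← integral_add (integrableOn_mul_exp hf ξ) (integrableOn_mul_exp hf (-ξ)),
    ← integral_const_mul, ← integral_const_mul]
  congr 1 with t
  rw [Complex.cos]
  push_cast
  ring_nf

lemma I_mul_fourierCoeffAt_sub_fourierCoeffAt_neg (hf : IntegrableOn f (Ico (-π) π)) (ξ : ℝ) :
    I * (fourierCoeffAt f ξ - fourierCoeffAt f (-ξ)) =
      1 / π * ∫ t in Ico (-π) π, f t * Complex.sin (ξ * t) := by
  rw [fourierCoeffAt, fourierCoeffAt, ← mul_sub,
    ← integral_sub (integrableOn_mul_exp hf ξ) (integrableOn_mul_exp hf (-ξ)),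
    ← integral_const_mul, ← integral_const_mul, ← integral_const_mul]
  congr 1 with t
  rw [Complex.sin]
  push_cast
  ring_nf

end RealForm

theorem IsCosineFourierCoeff.salemCosineCondition {a : ℕ → ℂ} (ha : IsCosineFourierCoeff a) :
    SalemCosineCondition a := by
  obtain ⟨f, hf, haf⟩ := ha
  have hcoeff : a = fun n : ℕ ↦ fourierCoeffAt f (n : ℤ) + fourierCoeffAt f (-n : ℤ) :=
    funext fun n ↦ by simp [haf, fourierCoeffAt_add_fourierCoeffAt_neg hf]
  rw [hcoeff]
  exact (discreteHilbertVanishes_fourierCoeffAt hf).salemCosineCondition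

theorem SalemSineCondition.congr {b b' : ℕ → ℂ} (hb : SalemSineCondition b)
    (h : ∀ n, 1 ≤ n → b n = b' n) : SalemSineCondition b' := by
  obtain ⟨B, hB, hlim⟩ := hb
  refine ⟨B, fun k ↦ (hB k).congr fun N ↦ Finset.sum_congr rfl fun n hn ↦ ?_, hlim⟩
  rw [h n (Finset.mem_Icc.1 hn).1]

theorem IsSineFourierCoeff.salemSineCondition {b : ℕ → ℂ} (hb : IsSineFourierCoeff b) :
    SalemSineCondition b := by
  obtain ⟨f, hf, hbf⟩ := hb
  refine (discreteHilbertVanishes_fourierCoeffAt hf).salemSineCondition.congr fun n hn ↦ ?_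
  rw [hbf n hn]
  simpa using I_mul_fourierCoeffAt_sub_fourierCoeffAt_neg hf n

end

theorem mainTheorem5 :
    -- the discrete Hilbert transform of a Fourier series exists and vanishes at infinity
    (∀ c : ℤ → ℂ, IsFourierSeries c → DiscreteHilbertVanishes c) ∧
    -- in the real form of the series, this condition reduces to the two conditions of Salem
    (∀ c : ℤ → ℂ, DiscreteHilbertVanishes c →
      SalemCosineCondition (fun n : ℕ => c (n : ℤ) + c (-(n : ℤ))) ∧
      SalemSineCondition (fun n : ℕ => Complex.I * (c (n : ℤ) - c (-(n : ℤ))))) ∧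
    -- hence the conditions of Salem are necessary
    (∀ a : ℕ → ℂ, IsCosineFourierCoeff a → SalemCosineCondition a) ∧
    (∀ b : ℕ → ℂ, IsSineFourierCoeff b → SalemSineCondition b) :=
  ⟨fun _ hc ↦ hc.discreteHilbertVanishes,
    fun _ hc ↦ ⟨hc.salemCosineCondition, hc.salemSineCondition⟩,
    fun _ ha ↦ ha.salemCosineCondition, fun _ hb ↦ hb.salemSineCondition⟩
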